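/- Let $\mathcal Q_2$ be the universal unital $C^*$-algebra generated by a unitary $u$ and an isometry $s_2$ subject to the relations $$s_2u=u^2s_2,\qquad s_2s_2^*+us_2s_2^*u^{-1}=1;$$ that is, $\mathcal Q_2$ is generated as a $C^*$-algebra by such a pair $(u,s_2)$, and for every unital $C^*$-algebra $A$ with a unitary $u'\in A$ and an isometry $s'\in A$ satisfying the same relations there is a unique unital $*$-homomorphism $\mathcal Q_2\to A$ with $u\mapsto u'$ and $s_2\mapsto s'$. Such an algebra exists (it is the Hausdorff completion of the free unital complex $*$-algebra on $u,s_2$ in the largest $C^*$-seminorm that vanishes on the relations), and it is purely infinite and simple: $\mathcal Q_2$ is nonzero and has no closed two-sided ideals other than $0$ and $\mathcal Q_2$, $\mathcal Q_2\neq\mathbb C 1$, and for every non-zero $x\in\mathcal Q_2$ there exist $y,z\in\mathcal Q_2$ with $yxz=1$. -/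

import Mathlib

/-- The relations (with `u⁻¹ = u*`): `u` is a unitary, `s` is an isometry, `s u = u² s`, and
`s s* + u s s* u⁻¹ = 1`. -/
structure Q2Relations {A : Type*} [Ring A] [StarRing A] (u s : A) : Prop where
  unitary : u ∈ unitary A
  isometry : star s * s = 1
  rel_I : s * u = u ^ 2 * s
  rel_II : s * star s + u * (s * star s) * star u = 1

/-! ### The free unital complex `*`-algebra on two generators -/

/-- The letters `u, u*, s, s*`. -/
inductive Q2Letter : Type
  | u : Q2Letter
  | uStar : Q2Letter
  | s : Q2Letter
  | sStar : Q2Letter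

/-- The involution on letters. -/
def Q2Letter.conj : Q2Letter → Q2Letter
  | .u => .uStar
  | .uStar => .u
  | .s => .sStar
  | .sStar => .s

/-- The free unital complex `*`-algebra on `u` and `s`: noncommutative `*`-polynomials,
i.e. the monoid algebra of the free monoid on the letters `u, u*, s, s*`. -/
def PreQ2 : Type := MonoidAlgebra ℂ (FreeMonoid Q2Letter)

namespace PreQ2

noncomputable instance : Ring PreQ2 :=
  inferInstanceAs (Ring (MonoidAlgebra ℂ (FreeMonoid Q2Letter)))

noncomputable instance : Algebra ℂ PreQ2 :=
  inferInstanceAs (Algebra ℂ (MonoidAlgebra ℂ (FreeMonoid Q2Letter)))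

/-- A word, as an element of the free algebra. -/
noncomputable def word : FreeMonoid Q2Letter →* PreQ2 :=
  MonoidAlgebra.of ℂ (FreeMonoid Q2Letter)

/-- A letter, as an element of the free algebra. -/
noncomputable def letter (x : Q2Letter) : PreQ2 := word (FreeMonoid.of x)

theorem induction {P : PreQ2 → Prop} (a : PreQ2) (zero : P 0)
    (add : ∀ a b, P a → P b → P (a + b)) (smul_word : ∀ (c : ℂ) w, P (c • word w)) : P a := by
  refine MonoidAlgebra.induction_linear (R := ℂ) (M := FreeMonoid Q2Letter) a zero add ?_
  intro m r
  have h : (MonoidAlgebra.single m r : MonoidAlgebra ℂ (FreeMonoid Q2Letter))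
      = r • MonoidAlgebra.of ℂ (FreeMonoid Q2Letter) m := by
    simp [MonoidAlgebra.of_apply]
  rw [h]
  exact smul_word r m

/-- The conjugate-linear anti-automorphism extending `Q2Letter.conj`, as a ring homomorphism to
the opposite ring. -/
noncomputable def starHom : PreQ2 →+* PreQ2ᵐᵒᵖ :=
  (MonoidAlgebra.liftNCRingHom ((algebraMap ℂ PreQ2ᵐᵒᵖ).comp (starRingEnd ℂ))
    (FreeMonoid.lift fun x => MulOpposite.op (letter x.conj))
    (fun c _ => Algebra.commutes (A := PreQ2ᵐᵒᵖ) (starRingEnd ℂ c) _) :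
      MonoidAlgebra ℂ (FreeMonoid Q2Letter) →+* PreQ2ᵐᵒᵖ)

theorem starHom_letter (x : Q2Letter) : starHom (letter x) = MulOpposite.op (letter x.conj) := by
  refine (MonoidAlgebra.liftNC_single _ _ _ _).trans ?_
  simp

theorem starHom_smul (c : ℂ) (a : PreQ2) : starHom (c • a) = star c • starHom a := by
  rw [Algebra.smul_def, map_mul, Algebra.smul_def]
  congr 1
  refine (MonoidAlgebra.liftNC_single _ _ _ _).trans ?_
  simp

theorem word_induction {P : FreeMonoid Q2Letter → Prop} (w : FreeMonoid Q2Letter) (one : P 1)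
    (mul : ∀ x w, P w → P (FreeMonoid.of x * w)) : P w :=
  FreeMonoid.recOn w one mul

theorem starHom_starHom (a : PreQ2) : (starHom (starHom a).unop).unop = a := by
  induction a using PreQ2.induction with
  | zero => simp
  | add a b ha hb => simp [ha, hb]
  | smul_word c w =>
    simp only [starHom_smul, MulOpposite.unop_smul, star_star]
    congr 1
    induction w using PreQ2.word_induction with
    | one => simp
    | mul x w ih =>
      have hx : word (FreeMonoid.of x) = letter x := rfl
      rw [map_mul, map_mul, MulOpposite.unop_mul, map_mul, MulOpposite.unop_mul, ih, hx,
        starHom_letter, MulOpposite.unop_op, starHom_letter, MulOpposite.unop_op]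
      cases x <;> rfl

noncomputable instance : StarRing PreQ2 where
  star a := (starHom a).unop
  star_involutive := starHom_starHom
  star_mul a b := by simp
  star_add a b := by simp

theorem star_def (a : PreQ2) : star a = (starHom a).unop := rfl

theorem star_letter (x : Q2Letter) : star (letter x) = letter x.conj := by
  rw [star_def, starHom_letter, MulOpposite.unop_op]

instance : StarModule ℂ PreQ2 where
  star_smul c a := by rw [star_def, starHom_smul]; rfl

/-! ### The universal C⋆-seminorm -/

/-- A C⋆-seminorm on the free `*`-algebra which vanishes on the relations defining `𝒬₂`. -/
structure IsAdmissible (p : Seminorm ℂ PreQ2) : Prop where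
  mul_le : ∀ a b, p (a * b) ≤ p a * p b
  star_mul_self : ∀ a, p (star a * a) = p a ^ 2
  star_u_mul_u : p (star (letter .u) * letter .u - 1) = 0
  u_mul_star_u : p (letter .u * star (letter .u) - 1) = 0
  star_s_mul_s : p (star (letter .s) * letter .s - 1) = 0
  rel_I : p (letter .s * letter .u - letter .u ^ 2 * letter .s) = 0
  rel_II : p (letter .s * star (letter .s)
    + letter .u * (letter .s * star (letter .s)) * star (letter .u) - 1) = 0

theorem IsAdmissible.zero : IsAdmissible 0 := by
  constructor <;> simp

theorem IsAdmissible.star_eq {p : Seminorm ℂ PreQ2} (hp : IsAdmissible p) (a : PreQ2) :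
    p (star a) = p a := by
  have key : ∀ a, p a ≤ p (star a) := fun a => by
    rcases (apply_nonneg p a).eq_or_lt with h | h
    · rw [← h]; exact apply_nonneg p _
    · have h1 := hp.mul_le (star a) a
      rw [hp.star_mul_self, sq] at h1
      exact le_of_mul_le_mul_right h1 h
  refine le_antisymm ?_ (key a)
  simpa using key (star a)

theorem IsAdmissible.one_le {p : Seminorm ℂ PreQ2} (hp : IsAdmissible p) : p 1 ≤ 1 := by
  have h := hp.star_mul_self 1
  rw [star_one, one_mul] at h
  nlinarith [apply_nonneg p 1]

theorem IsAdmissible.isometry_le {p : Seminorm ℂ PreQ2} (hp : IsAdmissible p) {a : PreQ2}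
    (ha : p (star a * a - 1) = 0) : p a ≤ 1 := by
  have h1 : p (star a * a) ≤ 1 := by
    calc p (star a * a) = p ((star a * a - 1) + 1) := by rw [sub_add_cancel]
      _ ≤ p (star a * a - 1) + p 1 := map_add_le_add p _ _
      _ ≤ 1 := by rw [ha, zero_add]; exact hp.one_le
  rw [hp.star_mul_self] at h1
  nlinarith [apply_nonneg p a]

theorem IsAdmissible.letter_le {p : Seminorm ℂ PreQ2} (hp : IsAdmissible p) (x : Q2Letter) :
    p (letter x) ≤ 1 := by
  have hu := hp.isometry_le hp.star_u_mul_u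
  have hs := hp.isometry_le hp.star_s_mul_s
  cases x with
  | u => exact hu
  | s => exact hs
  | uStar => rw [← hp.star_eq, star_letter]; exact hu
  | sStar => rw [← hp.star_eq, star_letter]; exact hs

theorem IsAdmissible.word_le {p : Seminorm ℂ PreQ2} (hp : IsAdmissible p)
    (w : FreeMonoid Q2Letter) : p (word w) ≤ 1 := by
  induction w using PreQ2.word_induction with
  | one => rw [map_one]; exact hp.one_le
  | mul x w ih =>
    rw [map_mul]
    exact (hp.mul_le _ _).trans (mul_le_one₀ (hp.letter_le x) (apply_nonneg p _) ih)

theorem bddAbove (a : PreQ2) :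
    BddAbove (Set.range fun p : {p : Seminorm ℂ PreQ2 // IsAdmissible p} => p.1 a) := by
  suffices h : ∃ C : ℝ, ∀ p : Seminorm ℂ PreQ2, IsAdmissible p → p a ≤ C by
    obtain ⟨C, hC⟩ := h
    refine ⟨C, ?_⟩
    rintro _ ⟨p, rfl⟩
    exact hC p.1 p.2
  induction a using PreQ2.induction with
  | zero => exact ⟨0, fun p _ => by simp⟩
  | add a b ha hb =>
    obtain ⟨C, hC⟩ := ha
    obtain ⟨D, hD⟩ := hb
    exact ⟨C + D, fun p hp => (map_add_le_add p a b).trans (add_le_add (hC p hp) (hD p hp))⟩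
  | smul_word c w =>
    refine ⟨‖c‖, fun p hp => ?_⟩
    rw [map_smul_eq_mul]
    exact mul_le_of_le_one_right (norm_nonneg c) (hp.word_le w)

/-- The universal C⋆-seminorm: the supremum of all admissible C⋆-seminorms. -/
noncomputable def univNorm (a : PreQ2) : ℝ :=
  ⨆ p : {p : Seminorm ℂ PreQ2 // IsAdmissible p}, p.1 a

instance : Nonempty {p : Seminorm ℂ PreQ2 // IsAdmissible p} := ⟨⟨0, IsAdmissible.zero⟩⟩

theorem le_univNorm {p : Seminorm ℂ PreQ2} (hp : IsAdmissible p) (a : PreQ2) :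
    p a ≤ univNorm a := le_ciSup (bddAbove a) ⟨p, hp⟩

theorem univNorm_le {a : PreQ2} {C : ℝ}
    (h : ∀ p : Seminorm ℂ PreQ2, IsAdmissible p → p a ≤ C) : univNorm a ≤ C :=
  ciSup_le fun p => h p.1 p.2

theorem univNorm_nonneg (a : PreQ2) : 0 ≤ univNorm a := le_univNorm IsAdmissible.zero a

theorem univNorm_eq_zero {a : PreQ2}
    (h : ∀ p : Seminorm ℂ PreQ2, IsAdmissible p → p a = 0) : univNorm a = 0 :=
  le_antisymm (univNorm_le fun p hp => (h p hp).le) (univNorm_nonneg a)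

theorem univNorm_mul_le (a b : PreQ2) : univNorm (a * b) ≤ univNorm a * univNorm b :=
  univNorm_le fun p hp => (hp.mul_le a b).trans <|
    mul_le_mul (le_univNorm hp a) (le_univNorm hp b) (apply_nonneg p b) (univNorm_nonneg a)

theorem univNorm_smul_le (c : ℂ) (a : PreQ2) : univNorm (c • a) ≤ ‖c‖ * univNorm a :=
  univNorm_le fun p hp => by
    rw [map_smul_eq_mul]
    exact mul_le_mul_of_nonneg_left (le_univNorm hp a) (norm_nonneg c)

theorem univNorm_star_le (a : PreQ2) : univNorm (star a) ≤ univNorm a :=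
  univNorm_le fun p hp => by rw [hp.star_eq]; exact le_univNorm hp a

theorem univNorm_sq_le (a : PreQ2) : univNorm a * univNorm a ≤ univNorm (star a * a) := by
  have h : univNorm a ≤ √(univNorm (star a * a)) := univNorm_le fun p hp =>
    Real.le_sqrt_of_sq_le (hp.star_mul_self a ▸ le_univNorm hp (star a * a))
  calc univNorm a * univNorm a
      ≤ √(univNorm (star a * a)) * √(univNorm (star a * a)) :=
        mul_self_le_mul_self (univNorm_nonneg a) h
    _ = univNorm (star a * a) := Real.mul_self_sqrt (univNorm_nonneg _)

noncomputable instance : SeminormedRing PreQ2 :=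
  { (RingSeminorm.toSeminormedRing
      { toFun := univNorm
        map_zero' := univNorm_eq_zero fun p _ => map_zero p
        add_le' := fun a b => univNorm_le fun p hp =>
          (map_add_le_add p a b).trans (add_le_add (le_univNorm hp a) (le_univNorm hp b))
        neg' := fun a => by simp only [univNorm, map_neg_eq_map]
        mul_le' := univNorm_mul_le } : SeminormedRing PreQ2) with
    toRing := inferInstance }

theorem norm_def (a : PreQ2) : ‖a‖ = univNorm a := rfl

noncomputable instance : NormedAlgebra ℂ PreQ2 where
  norm_smul_le := univNorm_smul_le

instance : NormedStarGroup PreQ2 where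
  norm_star_le := univNorm_star_le

end PreQ2

/-- `𝒬₂`, the universal unital C⋆-algebra generated by a unitary `u` and an isometry `s₂` with
`s₂ u = u² s₂` and `s₂ s₂* + u s₂ s₂* u⁻¹ = 1`: the Hausdorff completion of the free `*`-algebra
for the largest C⋆-seminorm which vanishes on the relations. -/
def Q2 : Type := UniformSpace.Completion PreQ2

namespace Q2

open UniformSpace

noncomputable instance : NormedRing Q2 := inferInstanceAs (NormedRing (Completion PreQ2))

noncomputable instance : NormedAlgebra ℂ Q2 :=
  { (inferInstanceAs (Algebra ℂ (Completion PreQ2)) : Algebra ℂ Q2) with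
    norm_smul_le := fun c x => norm_smul_le (β := Completion PreQ2) c x }

instance : CompleteSpace Q2 := inferInstanceAs (CompleteSpace (Completion PreQ2))

/-- The canonical map from `*`-polynomials in `u, s₂` to `𝒬₂`. -/
noncomputable def mk (a : PreQ2) : Q2 := (a : Completion PreQ2)

theorem continuous_mk : Continuous mk := Completion.continuous_coe PreQ2

theorem mk_zero : mk 0 = 0 := rfl

theorem mk_one : mk 1 = 1 := rfl

theorem mk_add (a b : PreQ2) : mk (a + b) = mk a + mk b := Completion.coe_add a b

theorem mk_sub (a b : PreQ2) : mk (a - b) = mk a - mk b := Completion.coe_sub a b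

theorem mk_mul (a b : PreQ2) : mk (a * b) = mk a * mk b := Completion.coe_mul a b

theorem mk_smul (c : ℂ) (a : PreQ2) : mk (c • a) = c • mk a := Completion.coe_smul c a

theorem norm_mk (a : PreQ2) : ‖mk a‖ = ‖a‖ := Completion.norm_coe a

theorem induction {P : Q2 → Prop} (x : Q2) (hP : IsClosed {x | P x}) (h : ∀ a, P (mk a)) :
    P x :=
  Completion.induction_on (α := PreQ2) x hP h

noncomputable instance : Star Q2 where
  star := Completion.map (star : PreQ2 → PreQ2)

theorem mk_star (a : PreQ2) : mk (star a) = star (mk a) :=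
  (Completion.map_coe (starNormedAddGroupHom (E := PreQ2)).uniformContinuous a).symm

theorem continuous_star' : Continuous (star : Q2 → Q2) :=
  Completion.continuous_map (α := PreQ2) (β := PreQ2)

noncomputable instance : StarRing Q2 where
  star_involutive x := by
    induction x using Q2.induction with
    | hP => exact isClosed_eq (continuous_star'.comp continuous_star') continuous_id
    | h a => rw [← mk_star, ← mk_star, star_star]
  star_mul x y := by
    induction x using Q2.induction with
    | hP =>
      exact isClosed_eq (continuous_star'.comp (continuous_id.mul continuous_const))
        (continuous_const.mul continuous_star')
    | h a =>
      induction y using Q2.induction with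
      | hP =>
        exact isClosed_eq (continuous_star'.comp (continuous_const.mul continuous_id))
          (continuous_star'.mul continuous_const)
      | h b => rw [← mk_mul, ← mk_star, ← mk_star, ← mk_star, ← mk_mul, star_mul]
  star_add x y := by
    induction x using Q2.induction with
    | hP =>
      exact isClosed_eq (continuous_star'.comp (continuous_id.add continuous_const))
        (continuous_star'.add continuous_const)
    | h a =>
      induction y using Q2.induction with
      | hP =>
        exact isClosed_eq (continuous_star'.comp (continuous_const.add continuous_id))
          (continuous_const.add continuous_star')
      | h b => rw [← mk_add, ← mk_star, ← mk_star, ← mk_star, ← mk_add, star_add]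

instance : CStarRing Q2 where
  norm_mul_self_le x := by
    induction x using Q2.induction with
    | hP =>
      exact isClosed_le (continuous_norm.mul continuous_norm)
        (continuous_norm.comp (continuous_star'.mul continuous_id))
    | h a =>
      rw [← mk_star, ← mk_mul, norm_mk, norm_mk]
      exact PreQ2.univNorm_sq_le a

instance : StarModule ℂ Q2 where
  star_smul c x := by
    induction x using Q2.induction with
    | hP =>
      exact isClosed_eq (continuous_star'.comp (continuous_const_smul c))
        (continuous_star'.const_smul (star c))
    | h a => rw [← mk_smul, ← mk_star, ← mk_star, ← mk_smul, star_smul]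

noncomputable instance : CStarAlgebra Q2 where

/-- The canonical unitary `u` of `𝒬₂`. -/
noncomputable def u : Q2 := mk (PreQ2.letter .u)

/-- The canonical isometry `s₂` of `𝒬₂`. -/
noncomputable def s : Q2 := mk (PreQ2.letter .s)

end Q2

/-- A C⋆-algebra is simple if it is nonzero and its only closed two-sided ideals are the
trivial ones. -/
def IsSimpleCStarAlgebra (A : Type*) [CStarAlgebra A] : Prop :=
  Nontrivial A ∧ ∀ I : TwoSidedIdeal A, IsClosed (I : Set A) → I = ⊥ ∨ I = ⊤

/-- A unital C⋆-algebra is purely infinite (and simple) if it consists of more than the scalars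
and for every `x ≠ 0` there are `y, z` with `y x z = 1`. -/
def IsPurelyInfiniteSimple (A : Type*) [CStarAlgebra A] : Prop :=
  (∃ a : A, ∀ c : ℂ, a ≠ algebraMap ℂ A c) ∧ ∀ x : A, x ≠ 0 → ∃ y z : A, y * x * z = 1

/-!
The generators `s` and `u s` are Cuntz isometries, and `u` acts on them as the binary odometer. On
the isometries `V n m = uⁿ sᵐ (u s)` with `n : ℤ` and `m : ℕ`, the generators act as on basis
vectors: `u V n m = V (n + 1) m`, `s V n m = V (2 n) (m + 1)`, and `s⋆` halves an even `n`,
lowering `m`, while it kills the odd ones. The ranges of `V n m` and `V n' m'` are orthogonal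
unless `(n, m) = (n', m')`, once `m` and `m'` are large compared with `n - n'`. Two facts follow,
in any C⋆-algebra generated by a pair `u, s` with the relations.

* For every `x` the compressions `V n (m + L)⋆ x V n' (m' + L)` are scalars in the limit
  `L → ∞` (`HasScalarCompressions.all`): on words in the generators they are eventually `0` or `1`.
* The elements `C N L = N⁻¹ ∑_{m < N} ∑_{0 ≤ n < 2ᵐ N} uⁿ sᵐ V n (m + L)⋆` satisfy `C C⋆ = 1`
  for large `L` and asymptotically commute with every `x` (`Q2Relations.asymptoticallyCommutes`).
  The index sets are Følner sets: the commutators with `u⋆` and `s⋆` telescope to boundary terms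
  of norm at most `2 / √N`. This is where amenability enters.

If no `y, z` satisfy `y x z = 1`, the limiting scalars of the compressions of `x` must vanish, for
otherwise some compression would be invertible. Hence `C N L x (C N L)⋆ → 0` as `L → ∞`, whereas
asymptotic commutation makes `C N L x (C N L)⋆` close to `x`. So `x = 0`
(`Q2Relations.exists_mul_mul_eq_one`), which gives pure infiniteness and simplicity.

The universal property holds because the norm pulled back along a representation of the relations
is an admissible seminorm. The algebra is nonzero because the relations are represented on `ℓ²(ℤ)`
by `u eₙ = eₙ₊₁` and `s eₙ = e₂ₙ`.
-/

open Filter Topology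

section Relations

variable {A : Type*} [CStarAlgebra A] {U : _root_.unitary A} {s : A}

/-! ### Orthonormal isometries permuted by the generators -/

/-- The isometry `uⁿ sᵐ`. In the representation on `ℓ²(ℤ)` its range is spanned by the basis
vectors indexed by the residue class of `n` modulo `2 ^ m`. -/
noncomputable def cyl (U : _root_.unitary A) (s : A) (n : ℤ) (m : ℕ) : A :=
  ((U ^ n : _root_.unitary A) : A) * s ^ m

/-- The isometry `uⁿ sᵐ (u s)`. The final factor `u s` makes the ranges of `frame U s n m` and
`frame U s n k` orthogonal for `m ≠ k`, since `s⋆ u s = 0`. -/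
noncomputable def frame (U : _root_.unitary A) (s : A) (n : ℤ) (m : ℕ) : A := cyl U s n m * (U * s)

theorem norm_le_one_of_star_mul_self_eq_one {v : A} (hv : star v * v = 1) : ‖v‖ ≤ 1 := by
  have h1 := CStarRing.norm_star_mul_self (x := v)
  rw [hv] at h1
  have h2 : ‖(1 : A)‖ ≤ 1 := by
    have h3 := CStarRing.norm_star_mul_self (x := (1 : A))
    rw [star_one, one_mul] at h3
    nlinarith [norm_nonneg (1 : A)]
  nlinarith [norm_nonneg v]

namespace Q2Relations

theorem s_mul_zpow (h : Q2Relations (U : A) s) (n : ℤ) :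
    s * ((U ^ n : _root_.unitary A) : A) = ((U ^ (2 * n) : _root_.unitary A) : A) * s := by
  have h1 : SemiconjBy s ((Unitary.toUnits U : Aˣ) : A) ((Unitary.toUnits (U ^ 2) : Aˣ) : A) := by
    simpa [SemiconjBy] using h.rel_I
  have h2 := h1.units_zpow_right n
  rw [← map_zpow, ← map_zpow, ← zpow_natCast, ← zpow_mul] at h2
  exact h2

/-- The ranges of `s` and `u s` are orthogonal, since their range projections add up to `1`. -/
theorem star_s_mul_u_mul_s (h : Q2Relations (U : A) s) : star s * ((U : A) * s) = 0 := by
  -- Compressing the second relation gives `2 • (s⋆ u s) = s⋆ u s`.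
  have h2 := congr_arg (fun x => star s * x * ((U : A) * s)) h.rel_II
  have e1 : star s * (s * star s + (U : A) * (s * star s) * star (U : A)) * ((U : A) * s)
      = (star s * s) * (star s * ((U : A) * s))
        + star s * ((U : A) * (s * (star s * (star (U : A) * (U : A)) * s))) := by noncomm_ring
  simp only [e1, h.isometry, Unitary.coe_star_mul_self, one_mul, mul_one] at h2
  simpa using h2

theorem star_s_mul_star_u_mul_s (h : Q2Relations (U : A) s) : star s * (star (U : A) * s) = 0 := by
  have := congr_arg star h.star_s_mul_u_mul_s
  simpa [mul_assoc] using this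

theorem s_mul_cyl (h : Q2Relations (U : A) s) (n : ℤ) (m : ℕ) :
    s * cyl U s n m = cyl U s (2 * n) (m + 1) := by
  rw [cyl, cyl, ← mul_assoc, h.s_mul_zpow, pow_succ', mul_assoc]

theorem star_s_mul_cyl_even (h : Q2Relations (U : A) s) (n : ℤ) (m : ℕ) :
    star s * cyl U s (2 * n) (m + 1) = cyl U s n m := by
  rw [← h.s_mul_cyl, ← mul_assoc, h.isometry, one_mul]

end Q2Relations

theorem u_mul_cyl (n : ℤ) (m : ℕ) : (U : A) * cyl U s n m = cyl U s (n + 1) m := by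
  rw [cyl, cyl, add_comm, zpow_one_add, ← mul_assoc]; rfl

theorem star_u_mul_cyl (n : ℤ) (m : ℕ) : star (U : A) * cyl U s n m = cyl U s (n - 1) m := by
  have := u_mul_cyl (U := U) (s := s) (n - 1) m
  rw [sub_add_cancel] at this
  rw [← this, ← mul_assoc, Unitary.coe_star_mul_self, one_mul]

theorem u_mul_frame (n : ℤ) (m : ℕ) : (U : A) * frame U s n m = frame U s (n + 1) m := by
  rw [frame, frame, ← mul_assoc, u_mul_cyl]

theorem star_u_mul_frame (n : ℤ) (m : ℕ) :
    star (U : A) * frame U s n m = frame U s (n - 1) m := by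
  rw [frame, frame, ← mul_assoc, star_u_mul_cyl]

theorem star_cyl_mul_cyl_add (a b n : ℤ) (m k : ℕ) :
    star (cyl U s (n + a) m) * cyl U s (n + b) k = star (cyl U s a m) * cyl U s b k := by
  simp only [cyl, zpow_add, star_mul, Submonoid.coe_mul]
  have : star ((U ^ n : _root_.unitary A) : A) * ((U ^ n : _root_.unitary A) : A) = 1 :=
    Unitary.coe_star_mul_self _
  calc _ = star (s ^ m) * star ((U ^ a : _root_.unitary A) : A) *
        (star ((U ^ n : _root_.unitary A) : A) * ((U ^ n : _root_.unitary A) : A))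
          * ((U ^ b : _root_.unitary A) : A) * s ^ k := by noncomm_ring
    _ = _ := by rw [this]; noncomm_ring

namespace Q2Relations

theorem star_s_mul_cyl_odd (h : Q2Relations (U : A) s) (n : ℤ) (m : ℕ) :
    star s * cyl U s (2 * n + 1) (m + 1) = 0 := by
  have h0 : cyl U s (2 * n + 1) (m + 1) = (U : A) * s * cyl U s n m := by
    rw [mul_assoc, h.s_mul_cyl, u_mul_cyl]
  rw [h0, ← mul_assoc, h.star_s_mul_u_mul_s, zero_mul]

theorem star_pow_mul_pow (h : Q2Relations (U : A) s) (m : ℕ) : star (s ^ m) * s ^ m = 1 := by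
  induction m with
  | zero => simp
  | succ m ih =>
    rw [pow_succ', star_mul, mul_assoc, ← mul_assoc (star s), h.isometry, one_mul, ih]

theorem star_cyl_mul_self (h : Q2Relations (U : A) s) (n : ℤ) (m : ℕ) :
    star (cyl U s n m) * cyl U s n m = 1 := by
  have := star_cyl_mul_cyl_add (U := U) (s := s) 0 0 n m m
  rw [add_zero] at this
  rw [this]
  simpa [cyl] using h.star_pow_mul_pow m

/-- Disjoint residue classes give orthogonal ranges. -/
theorem star_cyl_mul_cyl_of_ne (h : Q2Relations (U : A) s) (m k : ℕ) (hmk : m ≤ k) (a b : ℤ)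
    (hab : a ≠ b) (hlt : |b - a| < 2 ^ m) : star (cyl U s a m) * cyl U s b k = 0 := by
  suffices H : ∀ d : ℤ, d ≠ 0 → |d| < 2 ^ m → star (s ^ m) * cyl U s d k = 0 by
    have h1 := star_cyl_mul_cyl_add (U := U) (s := s) 0 (b - a) a m k
    rw [add_zero, add_sub_cancel] at h1
    rw [h1]
    simpa [cyl] using H (b - a) (sub_ne_zero.2 hab.symm) hlt
  clear hlt hab
  induction m generalizing k with
  | zero => intro d hd hlt; rw [pow_zero, abs_lt] at hlt; omega
  | succ m ih =>
    intro d hd hlt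
    obtain ⟨k, rfl⟩ : ∃ k', k = k' + 1 := ⟨k - 1, by omega⟩
    rw [pow_succ', star_mul, mul_assoc]
    rcases Int.even_or_odd' d with ⟨e, rfl | rfl⟩
    · rw [h.star_s_mul_cyl_even]
      refine ih k (by omega) e (by omega) ?_
      rw [abs_mul, pow_succ'] at hlt
      simpa using hlt
    · rw [h.star_s_mul_cyl_odd, mul_zero]

theorem s_mul_frame (h : Q2Relations (U : A) s) (n : ℤ) (m : ℕ) :
    s * frame U s n m = frame U s (2 * n) (m + 1) := by
  rw [frame, frame, ← mul_assoc, h.s_mul_cyl]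

theorem star_s_mul_frame_even (h : Q2Relations (U : A) s) (n : ℤ) (m : ℕ) :
    star s * frame U s (2 * n) (m + 1) = frame U s n m := by
  rw [frame, frame, ← mul_assoc, h.star_s_mul_cyl_even]

theorem star_s_mul_frame_odd (h : Q2Relations (U : A) s) (n : ℤ) (m : ℕ) :
    star s * frame U s (2 * n + 1) (m + 1) = 0 := by
  rw [frame, ← mul_assoc, h.star_s_mul_cyl_odd, zero_mul]

theorem star_u_mul_s_mul_self (h : Q2Relations (U : A) s) :
    star ((U : A) * s) * ((U : A) * s) = 1 := by
  rw [star_mul, mul_assoc, ← mul_assoc (star (U : A)), Unitary.coe_star_mul_self, one_mul,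
    h.isometry]

theorem star_frame_mul_frame_of_le (h : Q2Relations (U : A) s) {a b : ℤ} {m k : ℕ} (hmk : m ≤ k)
    (hlt : |b - a| < 2 ^ m) :
    star (frame U s a m) * frame U s b k = if a = b ∧ m = k then 1 else 0 := by
  have e : star (frame U s a m) * frame U s b k
      = star ((U : A) * s) * (star (cyl U s a m) * cyl U s b k) * ((U : A) * s) := by
    simp only [frame, star_mul]; noncomm_ring
  rw [e]
  by_cases hab : a = b
  · subst hab
    obtain ⟨j, rfl⟩ := Nat.exists_eq_add_of_le hmk
    have e2 : cyl U s a (m + j) = cyl U s a m * s ^ j := by rw [cyl, cyl, pow_add, mul_assoc]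
    rw [e2, ← mul_assoc (star _) (cyl U s a m), h.star_cyl_mul_self, one_mul]
    cases j with
    | zero => simpa using h.star_u_mul_s_mul_self
    | succ j =>
      rw [pow_succ', star_mul]
      calc _ = (star s * (star (U : A) * s)) * (s ^ j * ((U : A) * s)) := by noncomm_ring
        _ = _ := by rw [h.star_s_mul_star_u_mul_s]; simp
  · rw [h.star_cyl_mul_cyl_of_ne m k hmk a b hab hlt]
    simp [hab]

/-- The isometries `frame U s a (m + L)` with `a` in a window shorter than `2 ^ L` are
orthonormal. -/
theorem star_frame_mul_frame (h : Q2Relations (U : A) s) {a b : ℤ} {L : ℕ}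
    (hlt : |b - a| < 2 ^ L) (m k : ℕ) :
    star (frame U s a (m + L)) * frame U s b (k + L) = if a = b ∧ m = k then 1 else 0 := by
  have key : ∀ j : ℕ, |b - a| < 2 ^ (j + L) := fun j =>
    hlt.trans_le (pow_le_pow_right₀ (by norm_num) (by omega))
  rcases le_total m k with hmk | hmk
  · rw [h.star_frame_mul_frame_of_le (by omega) (key m)]
    simp
  · have := congr_arg star
      (h.star_frame_mul_frame_of_le (a := b) (b := a) (m := k + L) (k := m + L) (by omega)
        (by rw [abs_sub_comm]; exact key k))
    rw [star_mul, star_star] at this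
    rw [this]
    simp only [add_left_inj, apply_ite star, star_one, star_zero]
    simp only [eq_comm]

theorem star_frame_mul_frame_natCast (h : Q2Relations (U : A) s) {a b B : ℕ} (ha : a ≤ B)
    (hb : b ≤ B) {L : ℕ} (hL : B < 2 ^ L) (m k : ℕ) :
    star (frame U s a (m + L)) * frame U s b (k + L) = if a = b ∧ m = k then 1 else 0 := by
  have hlt : |(b : ℤ) - a| < 2 ^ L := by
    zify at hL ha hb
    rw [abs_lt]
    constructor <;> linarith [Int.natCast_nonneg a, Int.natCast_nonneg b]
  simpa using h.star_frame_mul_frame hlt m k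

theorem norm_cyl_le (h : Q2Relations (U : A) s) (n : ℤ) (m : ℕ) : ‖cyl U s n m‖ ≤ 1 :=
  norm_le_one_of_star_mul_self_eq_one (h.star_cyl_mul_self n m)

theorem star_frame_mul_self (h : Q2Relations (U : A) s) (n : ℤ) (m : ℕ) :
    star (frame U s n m) * frame U s n m = 1 := by
  rw [h.star_frame_mul_frame_of_le le_rfl (by simp)]
  simp

theorem norm_frame_le (h : Q2Relations (U : A) s) (n : ℤ) (m : ℕ) : ‖frame U s n m‖ ≤ 1 :=
  norm_le_one_of_star_mul_self_eq_one (h.star_frame_mul_self n m)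

end Q2Relations

theorem sum_range_two_mul {M : Type*} [AddCommMonoid M] (f : ℕ → M) (K : ℕ) :
    ∑ n ∈ Finset.range (2 * K), f n = ∑ n ∈ Finset.range K, (f (2 * n) + f (2 * n + 1)) := by
  induction K with
  | zero => simp
  | succ K ih =>
    rw [mul_add, mul_one, Finset.sum_range_succ, Finset.sum_range_succ, ih,
      Finset.sum_range_succ, add_assoc]

theorem sum_mul_star_mul_star_sum {ι : Type*} [DecidableEq ι] (F : Finset ι) (a v : ι → A)
    (hv : ∀ i ∈ F, ∀ j ∈ F, star (v i) * v j = if i = j then 1 else 0) :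
    (∑ i ∈ F, a i * star (v i)) * star (∑ i ∈ F, a i * star (v i)) = ∑ i ∈ F, a i * star (a i) := by
  rw [star_sum, Finset.sum_mul_sum]
  refine Finset.sum_congr rfl fun i hi => ?_
  rw [Finset.sum_eq_single i]
  · rw [star_mul, star_star, mul_assoc, ← mul_assoc (star (v i)), hv i hi i hi]
    simp
  · intro j hj hij
    rw [star_mul, star_star, mul_assoc, ← mul_assoc (star (v i)), hv i hi j hj]
    simp [hij.symm]
  · exact fun h => absurd hi h

/-- For an orthonormal family `v`, the sum `∑ aᵢ vᵢ⋆` has the norm of the row `(aᵢ)`. -/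
theorem norm_sum_mul_star_sq {ι : Type*} [DecidableEq ι] (F : Finset ι) (a v : ι → A)
    (hv : ∀ i ∈ F, ∀ j ∈ F, star (v i) * v j = if i = j then 1 else 0) :
    ‖∑ i ∈ F, a i * star (v i)‖ ^ 2 = ‖∑ i ∈ F, a i * star (a i)‖ := by
  rw [← sum_mul_star_mul_star_sum F a v hv, CStarRing.norm_self_mul_star, sq]

/-- The residue classes modulo `2 ^ m` partition `ℤ`, and `2 ^ m * N` consecutive integers meet each
of them `N` times. -/
theorem Q2Relations.sum_cyl_mul_star (h : Q2Relations (U : A) s) (N m : ℕ) :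
    ∑ n ∈ Finset.range (2 ^ m * N), cyl U s n m * star (cyl U s n m) = (N : A) := by
  induction m with
  | zero =>
    have e (n : ℕ) : cyl U s n 0 * star (cyl U s n 0) = 1 := by
      rw [cyl, pow_zero, mul_one, Unitary.mul_star_self_of_mem (U ^ (n : ℤ)).2]
    simp [e]
  | succ m ih =>
    rw [pow_succ', mul_assoc, sum_range_two_mul]
    have e : ∀ n : ℕ, cyl U s (2 * n : ℕ) (m + 1) * star (cyl U s (2 * n : ℕ) (m + 1))
        + cyl U s (2 * n + 1 : ℕ) (m + 1) * star (cyl U s (2 * n + 1 : ℕ) (m + 1))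
        = s * (cyl U s n m * star (cyl U s n m)) * star s
          + U * (s * (cyl U s n m * star (cyl U s n m)) * star s) * star (U : A) := fun n => by
      push_cast
      rw [← u_mul_cyl, ← h.s_mul_cyl]
      simp only [star_mul, mul_assoc]
    simp only [e]
    simp only [Finset.sum_add_distrib, ← Finset.sum_mul, ← Finset.mul_sum, ih]
    have e2 : s * (N : A) * star s = (N : A) * (s * star s) := by
      rw [(Nat.cast_commute N s).symm.eq, mul_assoc]
    rw [e2]
    calc (N : A) * (s * star s) + (U : A) * ((N : A) * (s * star s)) * star (U : A)
        = (N : A) * (s * star s + (U : A) * (s * star s) * star (U : A)) := by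
          rw [mul_add, ← mul_assoc (U : A) (N : A), (Nat.cast_commute N (U : A)).symm.eq]
          simp only [mul_assoc]
      _ = N := by rw [h.rel_II, mul_one]

/-! ### Asymptotically central coisometries -/

theorem norm_natCast_le_natCast (N : ℕ) : ‖(N : A)‖ ≤ N := by
  have h1 : ‖(1 : A)‖ ≤ 1 := norm_le_one_of_star_mul_self_eq_one (by simp)
  have := norm_nsmul_le (n := N) (a := (1 : A))
  rw [nsmul_one] at this
  nlinarith [Nat.cast_nonneg (α := ℝ) N]

/-- The pairs `⟨m, n⟩` with `m < N` and `n < 2 ^ m * N`: a Følner set for the partial maps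
`(m, n) ↦ (m, n + 1)` and `(m, n) ↦ (m + 1, 2 * n)`. -/
def boxIndex (N : ℕ) : Finset ((_ : ℕ) × ℕ) :=
  (Finset.range N).sigma fun m => Finset.range (2 ^ m * N)

theorem le_of_mem_boxIndex {N : ℕ} {p : (_ : ℕ) × ℕ} (hp : p ∈ boxIndex N) : p.2 ≤ 2 ^ N * N := by
  simp only [boxIndex, Finset.mem_sigma, Finset.mem_range] at hp
  exact hp.2.le.trans (Nat.mul_le_mul_right N (Nat.pow_le_pow_right (by norm_num) hp.1.le))

/-- The sum of `uⁿ sᵐ V n (m + L)⋆` over the box `boxIndex N`, where `V` is `frame`. -/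
noncomputable def boxSum (U : _root_.unitary A) (s : A) (N L : ℕ) : A :=
  ∑ p ∈ boxIndex N, cyl U s p.2 p.1 * star (frame U s p.2 (p.1 + L))

/-- The normalization of `boxSum`, a coisometry for large `L`; see `Q2Relations.box_mul_star`. -/
noncomputable def box (U : _root_.unitary A) (s : A) (N L : ℕ) : A :=
  (N : ℂ)⁻¹ • boxSum U s N L

/-- Since `V n⋆ u⋆ = V (n + 1)⋆`, the commutator telescopes in `n`. -/
theorem boxSum_mul_star_u_sub (N L : ℕ) :
    boxSum U s N L * star (U : A) - star (U : A) * boxSum U s N L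
      = ∑ m ∈ Finset.range N, cyl U s ((2 ^ m * N : ℕ) - 1 : ℤ) m
            * star (frame U s (2 ^ m * N : ℕ) (m + L))
        - ∑ m ∈ Finset.range N, cyl U s (-1) m * star (frame U s (0 : ℕ) (m + L)) := by
  rw [boxSum, boxIndex, Finset.sum_sigma, Finset.sum_mul, Finset.mul_sum,
    ← Finset.sum_sub_distrib, ← Finset.sum_sub_distrib]
  refine Finset.sum_congr rfl fun m _ => ?_
  have := Finset.sum_range_sub
    (fun n : ℕ => cyl U s ((n : ℤ) - 1) m * star (frame U s n (m + L))) (2 ^ m * N)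
  simp only [Nat.cast_zero, zero_sub] at this
  simp only [Nat.cast_zero]
  rw [← this, Finset.sum_mul, Finset.mul_sum, ← Finset.sum_sub_distrib]
  refine Finset.sum_congr rfl fun n _ => ?_
  congr 1
  · rw [mul_assoc, ← star_mul, u_mul_frame]
    simp
  · rw [← mul_assoc, star_u_mul_cyl]

namespace Q2Relations

theorem boxSum_mul_star (h : Q2Relations (U : A) s) {N L : ℕ} (hL : 2 ^ N * N < 2 ^ L) :
    boxSum U s N L * star (boxSum U s N L) = (N : A) * (N : A) := by
  rw [boxSum, sum_mul_star_mul_star_sum]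
  · rw [boxIndex, Finset.sum_sigma]
    simp only [h.sum_cyl_mul_star]
    simp
  · intro p hp q hq
    rw [h.star_frame_mul_frame_natCast (le_of_mem_boxIndex hp) (le_of_mem_boxIndex hq) hL]
    obtain ⟨m, a⟩ := p
    obtain ⟨k, b⟩ := q
    simp only [Sigma.mk.injEq, heq_eq_eq, and_comm]

theorem box_mul_star (h : Q2Relations (U : A) s) {N L : ℕ} (hN : N ≠ 0) (hL : 2 ^ N * N < 2 ^ L) :
    box U s N L * star (box U s N L) = 1 := by
  rw [box, star_smul, smul_mul_smul_comm, h.boxSum_mul_star hL]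
  have : (N : A) * (N : A) = ((N : ℂ) * (N : ℂ)) • (1 : A) := by
    rw [← Algebra.algebraMap_eq_smul_one]; simp
  have hN' : (N : ℂ) ≠ 0 := Nat.cast_ne_zero.2 hN
  rw [this, smul_smul]
  have : (N : ℂ)⁻¹ * star ((N : ℂ)⁻¹) * (N * N) = 1 := by
    simp; field_simp
  rw [this, one_smul]

theorem norm_box_le (h : Q2Relations (U : A) s) {N L : ℕ} (hN : N ≠ 0) (hL : 2 ^ N * N < 2 ^ L) :
    ‖box U s N L‖ ≤ 1 := by
  rw [← norm_star]
  exact norm_le_one_of_star_mul_self_eq_one (by rw [star_star, h.box_mul_star hN hL])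

/-- Boundary terms of the box in the direction of `u`: one index `b m` for each `m < N`. -/
theorem norm_sum_cyl_mul_star_frame_le (h : Q2Relations (U : A) s) {N L : ℕ}
    (hL : 2 ^ N * N < 2 ^ L) (a : ℕ → ℤ) (b : ℕ → ℕ) (hb : ∀ m < N, b m ≤ 2 ^ N * N) :
    ‖∑ m ∈ Finset.range N, cyl U s (a m) m * star (frame U s (b m) (m + L))‖ ≤ √N := by
  refine Real.le_sqrt_of_sq_le ?_
  rw [norm_sum_mul_star_sq]
  · refine (norm_sum_le _ _).trans ?_
    refine (Finset.sum_le_card_nsmul _ _ 1 fun m _ => ?_).trans (by simp)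
    rw [CStarRing.norm_self_mul_star]
    exact mul_le_one₀ (h.norm_cyl_le _ _) (norm_nonneg _) (h.norm_cyl_le _ _)
  · intro m hm k hk
    rw [h.star_frame_mul_frame_natCast (hb m (Finset.mem_range.1 hm))
      (hb k (Finset.mem_range.1 hk)) hL]
    congr 1
    exact propext ⟨fun hmk => hmk.2, fun hmk => ⟨by rw [hmk], hmk⟩⟩

theorem norm_boxSum_mul_star_u_sub_le (h : Q2Relations (U : A) s) {N L : ℕ}
    (hL : 2 ^ N * N < 2 ^ L) :
    ‖boxSum U s N L * star (U : A) - star (U : A) * boxSum U s N L‖ ≤ 2 * √N := by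
  rw [boxSum_mul_star_u_sub, two_mul]
  refine (norm_sub_le _ _).trans (add_le_add ?_ ?_)
  · refine h.norm_sum_cyl_mul_star_frame_le hL (fun m => (2 ^ m * N : ℕ) - 1) (fun m => 2 ^ m * N)
      fun m hm => Nat.mul_le_mul_right N (Nat.pow_le_pow_right (by norm_num) hm.le)
  · exact h.norm_sum_cyl_mul_star_frame_le hL (fun m => -1) (fun m => 0) fun m hm => Nat.zero_le _

/-- With `g m = ∑ₙ s⋆ uⁿ sᵐ V n (m + L)⋆`, the relation `V n m⋆ s⋆ = V (2 n) (m + 1)⋆` turns the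
product with `s⋆` on the right into `∑ g (m + 1)`, so that the commutator telescopes in `m`. -/
theorem boxSum_mul_star_s_sub (h : Q2Relations (U : A) s) (N L : ℕ) :
    boxSum U s N L * star s - star s * boxSum U s N L
      = ∑ n ∈ Finset.range (2 ^ N * N), star s * cyl U s n N * star (frame U s n (N + L))
        - ∑ n ∈ Finset.range (2 ^ 0 * N), star s * cyl U s n 0 * star (frame U s n (0 + L)) := by
  rw [boxSum, boxIndex, Finset.sum_sigma, Finset.sum_mul, Finset.mul_sum]
  rw [← Finset.sum_range_sub (fun m => ∑ n ∈ Finset.range (2 ^ m * N),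
    star s * cyl U s n m * star (frame U s n (m + L))), ← Finset.sum_sub_distrib]
  refine Finset.sum_congr rfl fun m _ => ?_
  congr 1
  · rw [pow_succ', mul_assoc 2, sum_range_two_mul, Finset.sum_mul]
    refine Finset.sum_congr rfl fun n _ => ?_
    push_cast
    rw [h.star_s_mul_cyl_even, h.star_s_mul_cyl_odd, zero_mul, add_zero, mul_assoc, ← star_mul,
      h.s_mul_frame, add_right_comm]
  · rw [Finset.mul_sum]
    simp only [mul_assoc]

/-- Boundary terms of the box in the direction of `s`: one layer `m`, containing
`2 ^ m * N` indices. -/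
theorem norm_layer_le (h : Q2Relations (U : A) s) {N L m : ℕ} (hm : m ≤ N)
    (hL : 2 ^ N * N < 2 ^ L) :
    ‖∑ n ∈ Finset.range (2 ^ m * N), star s * cyl U s n m * star (frame U s n (m + L))‖ ≤ √N := by
  have hmN : 2 ^ m * N ≤ 2 ^ N * N :=
    Nat.mul_le_mul_right N (Nat.pow_le_pow_right (by norm_num) hm)
  refine Real.le_sqrt_of_sq_le ?_
  rw [norm_sum_mul_star_sq]
  · have e : ∑ n ∈ Finset.range (2 ^ m * N), star s * cyl U s n m * star (star s * cyl U s n m)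
        = (N : A) := by
      have : ∀ n : ℕ, star s * cyl U s n m * star (star s * cyl U s n m)
          = star s * (cyl U s n m * star (cyl U s n m)) * s := fun n => by
        rw [star_mul, star_star]; simp only [mul_assoc]
      simp only [this]
      rw [← Finset.sum_mul, ← Finset.mul_sum, h.sum_cyl_mul_star, mul_assoc,
        (Nat.cast_commute N s).eq, ← mul_assoc, h.isometry, one_mul]
    rw [e]
    exact norm_natCast_le_natCast N
  · intro a ha b hb
    rw [h.star_frame_mul_frame_natCast ((Finset.mem_range.1 ha).le.trans hmN)
      ((Finset.mem_range.1 hb).le.trans hmN) hL]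
    simp

theorem norm_boxSum_mul_star_s_sub_le (h : Q2Relations (U : A) s) {N L : ℕ}
    (hL : 2 ^ N * N < 2 ^ L) :
    ‖boxSum U s N L * star s - star s * boxSum U s N L‖ ≤ 2 * √N := by
  rw [h.boxSum_mul_star_s_sub, two_mul]
  exact (norm_sub_le _ _).trans
    (add_le_add (h.norm_layer_le le_rfl hL) (h.norm_layer_le (Nat.zero_le N) hL))

end Q2Relations

/-- The filter on pairs `(N, L)` for the iterated limit: first `L → ∞`, then `N → ∞`. -/
abbrev boxFilter : Filter (ℕ × ℕ) := (atTop : Filter ℕ).curry (atTop : Filter ℕ)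

theorem eventually_boxFilter : ∀ᶠ p : ℕ × ℕ in boxFilter, p.1 ≠ 0 ∧ 2 ^ p.1 * p.1 < 2 ^ p.2 := by
  rw [eventually_curry_iff]
  filter_upwards [eventually_ne_atTop 0] with N hN
  filter_upwards [(tendsto_pow_atTop_atTop_of_one_lt (one_lt_two (α := ℕ))).eventually_gt_atTop
    (2 ^ N * N)] with L hL using ⟨hN, hL⟩

/-- The commutators of `x` with `box U s N L` tend to `0` along `boxFilter`. -/
def AsymptoticallyCommutes (U : _root_.unitary A) (s x : A) : Prop :=
  Tendsto (fun p : ℕ × ℕ => box U s p.1 p.2 * x - x * box U s p.1 p.2) boxFilter (𝓝 0)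

theorem asymptoticallyCommutes_of_norm_le {x : A}
    (hx : ∀ N L : ℕ, 2 ^ N * N < 2 ^ L → ‖boxSum U s N L * x - x * boxSum U s N L‖ ≤ 2 * √N) :
    AsymptoticallyCommutes U s x := by
  have hlim : Tendsto (fun N : ℕ => 2 * (√(N : ℝ))⁻¹) atTop (𝓝 0) := by
    have : Tendsto (fun N : ℕ => √(N : ℝ)) atTop atTop :=
      Real.tendsto_sqrt_atTop.comp tendsto_natCast_atTop_atTop
    simpa using this.inv_tendsto_atTop.const_mul 2
  have hfst : Tendsto (Prod.fst : ℕ × ℕ → ℕ) boxFilter atTop :=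
    tendsto_fst.mono_left curry_le_prod
  refine squeeze_zero_norm' ?_ (hlim.comp hfst)
  filter_upwards [eventually_boxFilter] with p hp
  obtain ⟨hN, hL⟩ := hp
  rw [box, smul_mul_assoc, mul_smul_comm, ← smul_sub, norm_smul, norm_inv, Complex.norm_natCast]
  have h0 : (0 : ℝ) < p.1 := Nat.cast_pos.2 (Nat.pos_of_ne_zero hN)
  calc (p.1 : ℝ)⁻¹ * _ ≤ (p.1 : ℝ)⁻¹ * (2 * √p.1) := by gcongr; exact hx _ _ hL
    _ = 2 * (√(p.1 : ℝ))⁻¹ := by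
      rw [← mul_left_inj' (Real.sqrt_pos.2 h0).ne', mul_assoc (2 : ℝ),
        inv_mul_cancel₀ (Real.sqrt_pos.2 h0).ne', mul_assoc, mul_assoc, Real.mul_self_sqrt h0.le]
      field_simp

namespace AsymptoticallyCommutes

theorem add {x y : A} (hx : AsymptoticallyCommutes U s x) (hy : AsymptoticallyCommutes U s y) :
    AsymptoticallyCommutes U s (x + y) := by
  have := Tendsto.add hx hy
  rw [add_zero] at this
  exact this.congr fun p => by noncomm_ring

theorem smul (c : ℂ) {x : A} (hx : AsymptoticallyCommutes U s x) :
    AsymptoticallyCommutes U s (c • x) := by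
  have := Tendsto.const_smul hx c
  rw [smul_zero] at this
  exact this.congr fun p => by rw [smul_sub, mul_smul_comm, smul_mul_assoc]

theorem mul {x y : A} (hx : AsymptoticallyCommutes U s x) (hy : AsymptoticallyCommutes U s y) :
    AsymptoticallyCommutes U s (x * y) := by
  have := (Tendsto.mul_const y hx).add (Tendsto.const_mul x hy)
  rw [zero_mul, mul_zero, add_zero] at this
  exact this.congr fun p => by noncomm_ring

theorem one : AsymptoticallyCommutes U s (1 : A) := by
  simpa [AsymptoticallyCommutes] using tendsto_const_nhds

theorem star_u (h : Q2Relations (U : A) s) : AsymptoticallyCommutes U s (star (U : A)) :=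
  asymptoticallyCommutes_of_norm_le fun _ _ hL => h.norm_boxSum_mul_star_u_sub_le hL

theorem star_s (h : Q2Relations (U : A) s) : AsymptoticallyCommutes U s (star s) :=
  asymptoticallyCommutes_of_norm_le fun _ _ hL => h.norm_boxSum_mul_star_s_sub_le hL

theorem of_u (h : Q2Relations (U : A) s) : AsymptoticallyCommutes U s (U : A) := by
  have := ((star_u h).const_mul (U : A)).mul_const (U : A)
  rw [mul_zero, zero_mul] at this
  rw [AsymptoticallyCommutes, ← neg_zero]
  refine this.neg.congr fun p => ?_
  set C := box U s p.1 p.2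
  have e1 : (U : A) * (C * star (U : A) - star (U : A) * C) * (U : A)
    = (U : A) * C * (star (U : A) * (U : A)) - ((U : A) * star (U : A)) * C * (U : A) := by
    noncomm_ring
  rw [e1, Unitary.star_mul_self_of_mem U.2, Unitary.mul_star_self_of_mem U.2, mul_one, one_mul,
    neg_sub]

theorem of_s (h : Q2Relations (U : A) s) : AsymptoticallyCommutes U s s := by
  -- With `C` the coisometry, `s [C, s⋆] s + u s [C, s⋆ u⋆] s = s C - C s`: the second relation
  -- collects the terms with `C` in the middle, and `s⋆ u⋆ s = 0` removes the remaining one.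
  have h1 := (((star_s h).const_mul s).mul_const s)
  have h2 := ((((star_s h).mul (star_u h)).const_mul ((U : A) * s)).mul_const s)
  have := (h1.add h2).neg
  simp only [mul_zero, zero_mul, add_zero, neg_zero] at this
  refine this.congr fun p => ?_
  set C := box U s p.1 p.2
  have e1 : -(s * (C * star s - star s * C) * s
      + (U : A) * s * (C * (star s * star (U : A)) - star s * star (U : A) * C) * s)
    = (s * star s + (U : A) * (s * star s) * star (U : A)) * C * s - s * C * (star s * s)
      - (U : A) * s * C * (star s * (star (U : A) * s)) := by noncomm_ring
  rw [e1, h.rel_II, h.isometry, h.star_s_mul_star_u_mul_s]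
  simp

end AsymptoticallyCommutes

namespace AsymptoticallyCommutes

theorem of_approx (h : Q2Relations (U : A) s) {x : A}
    (hx : ∀ ε > 0, ∃ y, AsymptoticallyCommutes U s y ∧ ‖x - y‖ < ε) :
    AsymptoticallyCommutes U s x := by
  refine Metric.tendsto_nhds.2 fun ε hε => ?_
  obtain ⟨y, hy, hxy⟩ := hx (ε / 4) (by positivity)
  filter_upwards [Metric.tendsto_nhds.1 hy (ε / 2) (by positivity), eventually_boxFilter]
    with p hp hp'
  have hC := h.norm_box_le hp'.1 hp'.2
  rw [dist_zero_right] at hp ⊢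
  set C := box U s p.1 p.2
  have e : C * x - x * C = (C * y - y * C) + C * (x - y) - (x - y) * C := by noncomm_ring
  rw [e]
  have h1 : ‖C * (x - y)‖ ≤ 1 * ‖x - y‖ := (norm_mul_le _ _).trans (by gcongr)
  have h2 : ‖(x - y) * C‖ ≤ ‖x - y‖ * 1 := (norm_mul_le _ _).trans (by gcongr)
  have h3 := norm_sub_le (C * y - y * C + C * (x - y)) ((x - y) * C)
  have h4 := norm_add_le (C * y - y * C) (C * (x - y))
  linarith

end AsymptoticallyCommutes

/-- Induction on the elements of a C⋆-algebra generated by `u` and `s`: words are built by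
multiplication by generators on the right, then linear combinations and limits are taken. -/
theorem generated_induction
    (hgen : (StarAlgebra.adjoin ℂ {(U : A), s}).topologicalClosure = ⊤) {P : A → Prop}
    (one : P 1) (add : ∀ x y, P x → P y → P (x + y)) (smul : ∀ (c : ℂ) x, P x → P (c • x))
    (mul_u : ∀ x, P x → P (x * U)) (mul_star_u : ∀ x, P x → P (x * star (U : A)))
    (mul_s : ∀ x, P x → P (x * s)) (mul_star_s : ∀ x, P x → P (x * star s))
    (approx : ∀ x, (∀ ε > 0, ∃ y, P y ∧ ‖x - y‖ < ε) → P x) (x : A) : P x := by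
  refine approx x fun ε hε => ?_
  have hx : x ∈ closure (StarAlgebra.adjoin ℂ {(U : A), s} : Set A) := by
    rw [← StarSubalgebra.topologicalClosure_coe, hgen]; trivial
  obtain ⟨y, hy, hxy⟩ := Metric.mem_closure_iff.1 hx ε hε
  refine ⟨y, ?_, by rwa [← dist_eq_norm]⟩
  clear hxy
  have hy' : y ∈ Submodule.span ℂ
      (Submonoid.closure ({(U : A), s} ∪ star {(U : A), s} : Set A) : Set A) := by
    rw [← Algebra.adjoin_eq_span]
    exact hy
  clear hy
  induction hy' using Submodule.span_induction with
  | mem w hw =>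
    induction hw using Submonoid.closure_induction_right with
    | one => exact one
    | mul_right x hx g hg ih =>
      simp only [Set.mem_union, Set.mem_insert_iff, Set.mem_singleton_iff, Set.mem_star] at hg
      rcases hg with (rfl | rfl) | (hg | hg)
      · exact mul_u _ ih
      · exact mul_s _ ih
      · rw [← star_star g, hg]; exact mul_star_u _ ih
      · rw [← star_star g, hg]; exact mul_star_s _ ih
  | zero => simpa using smul 0 1 one
  | add x y _ _ hx hy => exact add _ _ hx hy
  | smul c x _ hx => exact smul c _ hx

theorem Q2Relations.asymptoticallyCommutes (h : Q2Relations (U : A) s)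
    (hgen : (StarAlgebra.adjoin ℂ {(U : A), s}).topologicalClosure = ⊤) (x : A) :
    AsymptoticallyCommutes U s x :=
  generated_induction hgen .one (fun _ _ hx hy => hx.add hy) (fun c _ hx => hx.smul c)
    (fun _ hx => hx.mul (.of_u h)) (fun _ hx => hx.mul (.star_u h))
    (fun _ hx => hx.mul (.of_s h)) (fun _ hx => hx.mul (.star_s h))
    (fun _ hx => .of_approx h hx) x

/-! ### Scalar compressions and pure infiniteness -/

/-- All compressions `V a (m + L)⋆ x V b (k + L)`, with `V` the isometries `frame`, are within any
`ε > 0` of a fixed scalar for large `L`. The shift by `L` makes room for the action of `s⋆`, which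
lowers the second index, and for orthogonality. -/
def HasScalarCompressions (U : _root_.unitary A) (s x : A) : Prop :=
  ∀ (a b : ℤ) (m k : ℕ), ∀ ε > 0, ∃ c : ℂ, ∀ᶠ L in atTop,
    ‖star (frame U s a (m + L)) * x * frame U s b (k + L) - algebraMap ℂ A c‖ < ε

namespace HasScalarCompressions

theorem add {x y : A} (hx : HasScalarCompressions U s x) (hy : HasScalarCompressions U s y) :
    HasScalarCompressions U s (x + y) := by
  intro a b m k ε hε
  obtain ⟨c, hc⟩ := hx a b m k (ε / 2) (by positivity)
  obtain ⟨d, hd⟩ := hy a b m k (ε / 2) (by positivity)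
  refine ⟨c + d, ?_⟩
  filter_upwards [hc, hd] with L h1 h2
  have e : star (frame U s a (m + L)) * (x + y) * frame U s b (k + L) - algebraMap ℂ A (c + d)
    = (star (frame U s a (m + L)) * x * frame U s b (k + L) - algebraMap ℂ A c)
     + (star (frame U s a (m + L)) * y * frame U s b (k + L) - algebraMap ℂ A d) := by
    rw [map_add]; noncomm_ring
  rw [e]
  exact (norm_add_le _ _).trans_lt (by linarith)

theorem smul (c : ℂ) {x : A} (hx : HasScalarCompressions U s x) :
    HasScalarCompressions U s (c • x) := by
  intro a b m k ε hε
  obtain ⟨d, hd⟩ := hx a b m k (ε / (‖c‖ + 1)) (by positivity)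
  refine ⟨c * d, ?_⟩
  filter_upwards [hd] with L h1
  have e : star (frame U s a (m + L)) * (c • x) * frame U s b (k + L) - algebraMap ℂ A (c * d)
    = c • (star (frame U s a (m + L)) * x * frame U s b (k + L) - algebraMap ℂ A d) := by
    rw [map_mul, smul_sub, mul_smul_comm, smul_mul_assoc, Algebra.smul_def c (algebraMap ℂ A d)]
  rw [e, norm_smul]
  rw [lt_div_iff₀ (by positivity)] at h1
  nlinarith [norm_nonneg (star (frame U s a (m + L)) * x * frame U s b (k + L) - algebraMap ℂ A d)]

theorem of_approx (h : Q2Relations (U : A) s) {x : A}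
    (hx : ∀ ε > 0, ∃ y, HasScalarCompressions U s y ∧ ‖x - y‖ < ε) :
    HasScalarCompressions U s x := by
  intro a b m k ε hε
  obtain ⟨y, hy, hxy⟩ := hx (ε / 2) (by positivity)
  obtain ⟨c, hc⟩ := hy a b m k (ε / 2) (by positivity)
  refine ⟨c, ?_⟩
  filter_upwards [hc] with L h1
  have e : star (frame U s a (m + L)) * x * frame U s b (k + L) - algebraMap ℂ A c
    = (star (frame U s a (m + L)) * y * frame U s b (k + L) - algebraMap ℂ A c)
     + star (frame U s a (m + L)) * (x - y) * frame U s b (k + L) := by noncomm_ring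
  rw [e]
  have h2 : ‖star (frame U s a (m + L)) * (x - y) * frame U s b (k + L)‖ ≤ 1 * ‖x - y‖ * 1 := by
    refine (norm_mul_le _ _).trans ?_
    gcongr
    · refine (norm_mul_le _ _).trans ?_
      gcongr
      rw [norm_star]
      exact h.norm_frame_le _ _
    · exact h.norm_frame_le _ _
  exact (norm_add_le _ _).trans_lt (by linarith)

/-- The compressions of `1` are scalars because the isometries `frame` are orthonormal. -/
theorem one (h : Q2Relations (U : A) s) : HasScalarCompressions U s (1 : A) := by
  intro a b m k ε hε
  refine ⟨if a = b ∧ m = k then 1 else 0, ?_⟩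
  obtain ⟨L₀, hL₀⟩ := pow_unbounded_of_one_lt |b - a| (one_lt_two (α := ℤ))
  filter_upwards [eventually_ge_atTop L₀] with L hL
  have key : |b - a| < 2 ^ L := hL₀.trans_le (pow_le_pow_right₀ (by norm_num) hL)
  rw [mul_one, h.star_frame_mul_frame key]
  split_ifs <;> simpa using hε

/-- It suffices that `g` maps each isometry `frame U s b (k + 1 + L)` to another one, or to `0`. -/
theorem mul_right {x g : A} (hx : HasScalarCompressions U s x)
    (hg : ∀ (b : ℤ) (k : ℕ), (∃ (b' : ℤ) (k' : ℕ), ∀ L,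
      g * frame U s b (k + (L + 1)) = frame U s b' (k' + L)) ∨
        ∀ L, g * frame U s b (k + (L + 1)) = 0) :
    HasScalarCompressions U s (x * g) := by
  intro a b m k ε hε
  -- Replacing `L` by `L + 1` allows the action of `s⋆` on `frame U s b k` with `k = 0`.
  suffices ∃ c : ℂ, ∀ᶠ L in atTop, ‖star (frame U s a (m + (L + 1))) * (x * g)
      * frame U s b (k + (L + 1)) - algebraMap ℂ A c‖ < ε by
    obtain ⟨c, hc⟩ := this
    refine ⟨c, ?_⟩
    rwa [← map_add_atTop_eq_nat 1, eventually_map]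
  simp only [← mul_assoc]
  simp only [mul_assoc _ g]
  rcases hg b k with ⟨b', k', hb⟩ | hb
  · obtain ⟨c, hc⟩ := hx a b' (m + 1) k' ε hε
    refine ⟨c, hc.mono fun L hL => ?_⟩
    rwa [hb L, add_comm L 1, ← add_assoc]
  · refine ⟨0, .of_forall fun L => ?_⟩
    rw [hb L]
    simpa using hε

theorem all (h : Q2Relations (U : A) s)
    (hgen : (StarAlgebra.adjoin ℂ {(U : A), s}).topologicalClosure = ⊤) (x : A) :
    HasScalarCompressions U s x := by
  refine generated_induction hgen (.one h) (fun _ _ hx hy => hx.add hy) (fun c _ hx => hx.smul c)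
    ?_ ?_ ?_ ?_ (fun _ hx => .of_approx h hx) x <;>
    refine fun x hx => hx.mul_right fun b k => ?_
  · exact .inl ⟨b + 1, k + 1, fun L => by rw [u_mul_frame]; congr 1; ring⟩
  · exact .inl ⟨b - 1, k + 1, fun L => by rw [star_u_mul_frame]; congr 1; ring⟩
  · exact .inl ⟨2 * b, k + 2, fun L => by rw [h.s_mul_frame]; congr 1; ring⟩
  · simp only [← add_assoc]
    rcases Int.even_or_odd' b with ⟨e, rfl | rfl⟩
    · exact .inl ⟨e, k, fun L => h.star_s_mul_frame_even _ _⟩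
    · exact .inr fun L => h.star_s_mul_frame_odd _ _

/-- A nonzero limiting scalar would make some compression of `x` invertible. -/
theorem tendsto_zero {x : A} (hx : HasScalarCompressions U s x)
    (hx' : ∀ y z : A, y * x * z ≠ 1) (a b : ℤ) (m k : ℕ) :
    Tendsto (fun L => star (frame U s a (m + L)) * x * frame U s b (k + L)) atTop (𝓝 0) := by
  have hx1 : Nontrivial A := ⟨1, _, (hx' 0 0).symm⟩
  refine Metric.tendsto_nhds.2 fun ε hε => ?_
  obtain ⟨c, hc⟩ := hx a b m k (ε / 2) (by positivity)
  filter_upwards [hc] with L hL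
  rw [dist_zero_right]
  set w := star (frame U s a (m + L)) * x * frame U s b (k + L) with hw
  suffices hce : ‖c‖ ≤ ε / 2 by
    have h1 := norm_add_le (w - algebraMap ℂ A c) (algebraMap ℂ A c)
    rw [sub_add_cancel, norm_algebraMap'] at h1
    linarith
  by_contra! hce
  have hc0 : c ≠ 0 := norm_pos_iff.1 ((by positivity : 0 < ε / 2).trans hce)
  -- The compression `w` lies within `‖c‖` of the scalar `c`, hence is invertible.
  let e : Aˣ := Units.map (algebraMap ℂ A).toMonoidHom (Units.mk0 c hc0)
  have hinv : ‖w - e‖ < ‖(↑e⁻¹ : A)‖⁻¹ := by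
    have : (↑e⁻¹ : A) = algebraMap ℂ A c⁻¹ := rfl
    rw [this, norm_algebraMap', norm_inv, inv_inv]
    exact hL.trans hce
  let f : Aˣ := Units.ofNearby e w hinv
  have hf : (↑f⁻¹ : A) * w = 1 := f.inv_mul
  refine hx' (↑f⁻¹ * star (frame U s a (m + L))) (frame U s b (k + L)) ?_
  rw [← hf, hw]
  simp only [mul_assoc]

end HasScalarCompressions

/-- Every C⋆-algebra generated by a pair with the relations is purely infinite and simple. -/
theorem Q2Relations.exists_mul_mul_eq_one (h : Q2Relations (U : A) s)
    (hgen : (StarAlgebra.adjoin ℂ {(U : A), s}).topologicalClosure = ⊤) {x : A} (hx : x ≠ 0) :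
    ∃ y z : A, y * x * z = 1 := by
  by_contra! hx'
  have hpos : 0 < ‖x‖ := norm_pos_iff.2 hx
  have hev := (Metric.tendsto_nhds.1 (h.asymptoticallyCommutes hgen x) (‖x‖ / 2)
    (by positivity)).and eventually_boxFilter
  obtain ⟨N, hN⟩ := (eventually_curry_iff.1 hev).exists
  have hlim : Tendsto (fun L => box U s N L * x * star (box U s N L)) atTop (𝓝 0) := by
    have e : ∀ L, box U s N L * x * star (box U s N L)
        = ((N : ℂ)⁻¹ * star (N : ℂ)⁻¹) • ∑ p ∈ boxIndex N, ∑ q ∈ boxIndex N,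
          cyl U s p.2 p.1 * (star (frame U s p.2 (p.1 + L)) * x * frame U s q.2 (q.1 + L))
            * star (cyl U s q.2 q.1) := fun L => by
      rw [box, star_smul, smul_mul_assoc, smul_mul_smul_comm, boxSum, star_sum, Finset.sum_mul,
        Finset.sum_mul_sum]
      simp only [star_mul, star_star, mul_assoc]
    simp only [e]
    rw [← smul_zero ((N : ℂ)⁻¹ * star (N : ℂ)⁻¹)]
    refine Tendsto.const_smul ?_ _
    rw [← Finset.sum_const_zero (s := boxIndex N)]
    refine tendsto_finsetSum _ fun p _ => ?_
    rw [← Finset.sum_const_zero (s := boxIndex N)]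
    refine tendsto_finsetSum _ fun q _ => ?_
    have := (((HasScalarCompressions.all h hgen x).tendsto_zero hx' p.2 q.2 p.1 q.1).const_mul
      (cyl U s p.2 p.1)).mul_const (star (cyl U s q.2 q.1))
    simpa using this
  obtain ⟨L, hL, hL1, hL2⟩ := ((Metric.tendsto_nhds.1 hlim (‖x‖ / 2) (by positivity)).and hN).exists
  have hC := h.norm_box_le hL2.1 hL2.2
  have hCC := h.box_mul_star hL2.1 hL2.2
  rw [dist_zero_right] at hL hL1
  simp only at hL hL1 hC hCC
  set C := box U s N L
  have e : x = C * x * star C - (C * x - x * C) * star C := by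
    rw [sub_mul, mul_assoc x, hCC]; simp
  have h1 : ‖(C * x - x * C) * star C‖ ≤ ‖C * x - x * C‖ * 1 := by
    refine (norm_mul_le _ _).trans ?_
    rw [norm_star]
    gcongr
  have h2 := norm_sub_le (C * x * star C) ((C * x - x * C) * star C)
  rw [← e] at h2
  linarith

end Relations

/-! ### The universal property -/

namespace PreQ2

variable {A : Type*} [CStarAlgebra A] (u s : A)

/-- The value of a letter when `u` and `s` are given values in `A`. -/
def letterVal : Q2Letter → A
  | .u => u
  | .uStar => star u
  | .s => s
  | .sStar => star s

/-- The evaluation of `*`-polynomials at a pair of elements of `A`. -/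
noncomputable def lift : PreQ2 →ₐ[ℂ] A :=
  (MonoidAlgebra.lift ℂ A (FreeMonoid Q2Letter) (FreeMonoid.lift (letterVal u s)) :
    MonoidAlgebra ℂ (FreeMonoid Q2Letter) →ₐ[ℂ] A)

theorem lift_word (w : FreeMonoid Q2Letter) :
    lift u s (word w) = FreeMonoid.lift (letterVal u s) w :=
  MonoidAlgebra.lift_of _ _

theorem lift_letter (x : Q2Letter) : lift u s (letter x) = letterVal u s x := by
  rw [letter, lift_word, FreeMonoid.lift_eval_of]

theorem lift_star (a : PreQ2) : lift u s (star a) = star (lift u s a) := by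
  induction a using PreQ2.induction with
  | zero => simp
  | add a b ha hb => simp [ha, hb]
  | smul_word c w =>
    rw [star_smul, map_smul, map_smul, star_smul]
    congr 1
    induction w using PreQ2.word_induction with
    | one => simp
    | mul x w ih =>
      have hx : word (FreeMonoid.of x) = letter x := rfl
      rw [map_mul, star_mul, map_mul, ih, map_mul, star_mul, hx, star_letter, lift_letter,
        lift_letter]
      cases x <;> simp [letterVal, Q2Letter.conj]

/-- The norm of `A` pulled back along `PreQ2.lift`. -/
noncomputable def liftSeminorm : Seminorm ℂ PreQ2 := (normSeminorm ℂ A).comp (lift u s).toLinearMap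

theorem liftSeminorm_apply (a : PreQ2) : liftSeminorm u s a = ‖lift u s a‖ := rfl

variable {u s}

theorem isAdmissible_liftSeminorm (h : Q2Relations u s) : IsAdmissible (liftSeminorm u s) := by
  have hu := h.unitary
  rw [Unitary.mem_iff] at hu
  constructor
  · intro a b
    simp only [liftSeminorm_apply, map_mul]
    exact norm_mul_le _ _
  · intro a
    simp only [liftSeminorm_apply, map_mul, lift_star, CStarRing.norm_star_mul_self, sq]
  all_goals simp only [liftSeminorm_apply, map_mul, map_add, map_sub, map_pow, map_one, lift_star,
    lift_letter, letterVal]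
  · simp [hu.1]
  · simp [hu.2]
  · simp [h.isometry]
  · simp [h.rel_I]
  · simp [h.rel_II]

theorem norm_lift_le (h : Q2Relations u s) (a : PreQ2) : ‖lift u s a‖ ≤ ‖a‖ :=
  le_univNorm (isAdmissible_liftSeminorm h) a

end PreQ2

namespace Q2

theorem mk_eq_zero {a : PreQ2} (ha : ∀ p, PreQ2.IsAdmissible p → p a = 0) : mk a = 0 := by
  rw [← norm_eq_zero, norm_mk, PreQ2.norm_def]
  exact PreQ2.univNorm_eq_zero ha

theorem relations : Q2Relations u s where
  unitary := by
    rw [Unitary.mem_iff]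
    simp only [u, ← mk_star, ← mk_mul, ← mk_one]
    constructor <;> rw [← sub_eq_zero, ← mk_sub]
    · exact mk_eq_zero fun p hp => hp.star_u_mul_u
    · exact mk_eq_zero fun p hp => hp.u_mul_star_u
  isometry := by
    rw [← sub_eq_zero]
    simp only [s, ← mk_star, ← mk_mul, ← mk_one, ← mk_sub]
    exact mk_eq_zero fun p hp => hp.star_s_mul_s
  rel_I := by
    rw [← sub_eq_zero, sq]
    simp only [u, s, ← mk_mul, ← mk_sub]
    rw [← sq]
    exact mk_eq_zero fun p hp => hp.rel_I
  rel_II := by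
    rw [← sub_eq_zero]
    simp only [u, s, ← mk_star, ← mk_mul, ← mk_one, ← mk_add, ← mk_sub]
    exact mk_eq_zero fun p hp => hp.rel_II

theorem mk_word_mem (w : FreeMonoid Q2Letter) :
    mk (PreQ2.word w) ∈ StarAlgebra.adjoin ℂ {u, s} := by
  have hu : u ∈ StarAlgebra.adjoin ℂ {u, s} := StarAlgebra.subset_adjoin ℂ _ (by simp)
  have hs : s ∈ StarAlgebra.adjoin ℂ {u, s} := StarAlgebra.subset_adjoin ℂ _ (by simp)
  induction w using PreQ2.word_induction with
  | one => rw [map_one, mk_one]; exact one_mem _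
  | mul x w ih =>
    rw [map_mul, mk_mul]
    refine mul_mem ?_ ih
    change mk (PreQ2.letter x) ∈ _
    cases x with
    | u => exact hu
    | s => exact hs
    | uStar =>
      have : PreQ2.letter .uStar = star (PreQ2.letter .u) := (PreQ2.star_letter .u).symm
      rw [this, mk_star]
      exact star_mem hu
    | sStar =>
      have : PreQ2.letter .sStar = star (PreQ2.letter .s) := (PreQ2.star_letter .s).symm
      rw [this, mk_star]
      exact star_mem hs

theorem mk_mem (a : PreQ2) : mk a ∈ StarAlgebra.adjoin ℂ {u, s} := by
  induction a using PreQ2.induction with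
  | zero => rw [mk_zero]; exact zero_mem _
  | add a b ha hb => rw [mk_add]; exact add_mem ha hb
  | smul_word c w => rw [mk_smul]; exact SMulMemClass.smul_mem c (mk_word_mem w)

theorem topologicalClosure_adjoin : (StarAlgebra.adjoin ℂ {u, s}).topologicalClosure = ⊤ := by
  refine eq_top_iff.2 fun x _ => ?_
  clear * -
  induction x using Q2.induction with
  | hP => exact StarSubalgebra.isClosed_topologicalClosure (StarAlgebra.adjoin ℂ {u, s})
  | h a => exact StarSubalgebra.le_topologicalClosure _ (mk_mem a)

section lift

variable {A : Type*} [CStarAlgebra A] {u' s' : A}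

theorem continuous_preLift (h : Q2Relations u' s') :
    Continuous (PreQ2.lift u' s' : PreQ2 →+* A) :=
  AddMonoidHomClass.continuous_of_bound (PreQ2.lift u' s') 1
    fun a => by simpa using PreQ2.norm_lift_le h a

/-- The continuous extension of `PreQ2.lift` to `𝒬₂`, as a ring homomorphism. -/
noncomputable def liftRingHom (h : Q2Relations u' s') : Q2 →+* A :=
  UniformSpace.Completion.extensionHom (PreQ2.lift u' s' : PreQ2 →+* A) (continuous_preLift h)

theorem liftRingHom_mk (h : Q2Relations u' s') (a : PreQ2) :
    liftRingHom h (mk a) = PreQ2.lift u' s' a :=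
  UniformSpace.Completion.extensionHom_coe _ (continuous_preLift h) a

theorem continuous_liftRingHom (h : Q2Relations u' s') : Continuous (liftRingHom h) :=
  UniformSpace.Completion.continuous_extension

/-- The `*`-homomorphism from `𝒬₂` given by a pair of elements satisfying the relations. -/
noncomputable def lift (h : Q2Relations u' s') : Q2 →⋆ₐ[ℂ] A where
  toRingHom := liftRingHom h
  commutes' c := by
    change liftRingHom h (algebraMap ℂ Q2 c) = _
    rw [Algebra.algebraMap_eq_smul_one, ← mk_one, ← mk_smul, liftRingHom_mk, map_smul, map_one,
      Algebra.algebraMap_eq_smul_one]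
  map_star' x := by
    change liftRingHom h (star x) = star (liftRingHom h x)
    induction x using Q2.induction with
    | hP =>
      exact isClosed_eq ((continuous_liftRingHom h).comp continuous_star')
        (continuous_star.comp (continuous_liftRingHom h))
    | h a => rw [← mk_star, liftRingHom_mk, liftRingHom_mk, PreQ2.lift_star]

theorem lift_mk (h : Q2Relations u' s') (a : PreQ2) : lift h (mk a) = PreQ2.lift u' s' a :=
  liftRingHom_mk h a

open scoped CStarAlgebra in
theorem hom_ext {φ ψ : Q2 →⋆ₐ[ℂ] A} (hu : φ u = ψ u) (hs : φ s = ψ s) : φ = ψ := by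
  have hle : StarAlgebra.adjoin ℂ {u, s} ≤ StarAlgHom.equalizer φ ψ := by
    refine StarAlgHom.adjoin_le_equalizer φ ψ ?_
    rintro x (rfl | rfl)
    exacts [hu, hs]
  ext x
  induction x using Q2.induction with
  | hP => exact isClosed_eq (map_continuous φ) (map_continuous ψ)
  | h a => exact hle (mk_mem a)

theorem existsUnique_hom (h : Q2Relations u' s') :
    ∃! φ : Q2 →⋆ₐ[ℂ] A, φ u = u' ∧ φ s = s' := by
  have h1 : lift h u = u' := (lift_mk h _).trans (PreQ2.lift_letter u' s' .u)
  have h2 : lift h s = s' := (lift_mk h _).trans (PreQ2.lift_letter u' s' .s)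
  exact ⟨lift h, ⟨h1, h2⟩, fun φ hφ => hom_ext (hφ.1.trans h1.symm) (hφ.2.trans h2.symm)⟩

end lift

end Q2

/-! ### The representation on `ℓ²(ℤ)` -/

/-- The Hilbert space `ℓ²(ℤ)`. -/
abbrev EllTwo : Type := lp (fun _ : ℤ => ℂ) 2

namespace EllTwo

/-- The standard basis vector `eₙ` of `ℓ²(ℤ)`. -/
noncomputable def basis (n : ℤ) : EllTwo := lp.single 2 n (1 : ℂ)

theorem inner_basis (n : ℤ) (f : EllTwo) : inner ℂ (basis n) f = f n := by
  rw [basis, lp.inner_single_left]; simp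

theorem basis_apply (n m : ℤ) : basis n m = if m = n then 1 else 0 := by
  simp [basis, Pi.single_apply]

theorem orthonormal_basis : Orthonormal ℂ basis := by
  rw [orthonormal_iff_ite]
  intro i j
  rw [inner_basis, basis_apply]

theorem ext_basis {S T : EllTwo →L[ℂ] EllTwo} (h : ∀ n, S (basis n) = T (basis n)) : S = T := by
  refine lp.ext_continuousLinearMap (by norm_num) fun n => ?_
  ext1
  simpa [basis] using h n

/-- The isometry of `ℓ²(ℤ)` with `eₙ ↦ e_{f n}`, for an injective `f`. -/
noncomputable def shift (f : ℤ → ℤ) (hf : Function.Injective f) : EllTwo →L[ℂ] EllTwo :=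
  ((orthonormal_basis.comp f hf).orthogonalFamily.linearIsometry).toContinuousLinearMap

variable {f : ℤ → ℤ} (hf : Function.Injective f)

theorem shift_basis (n : ℤ) : shift f hf (basis n) = basis (f n) := by
  simp [shift, basis]

theorem star_shift_apply (g : EllTwo) (n : ℤ) : star (shift f hf) g n = g (f n) := by
  rw [← inner_basis, ContinuousLinearMap.star_eq_adjoint, ContinuousLinearMap.adjoint_inner_right,
    shift_basis, inner_basis]

theorem star_shift_basis (n : ℤ) : star (shift f hf) (basis (f n)) = basis n := by
  ext m
  rw [star_shift_apply, basis_apply, basis_apply]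
  simp [hf.eq_iff]

theorem star_shift_basis_of_notMem {n : ℤ} (hn : n ∉ Set.range f) :
    star (shift f hf) (basis n) = 0 := by
  ext m
  rw [star_shift_apply, basis_apply, if_neg]
  · rfl
  · rintro rfl; exact hn ⟨m, rfl⟩

theorem star_shift_mul_shift : star (shift f hf) * shift f hf = 1 :=
  ext_basis fun n => by
    rw [mul_apply_eq_comp, shift_basis, star_shift_basis]; rfl

theorem relations : Q2Relations (shift (· + 1) (add_left_injective 1))
    (shift (2 * ·) (mul_right_injective₀ two_ne_zero)) := by
  have hsucc (n : ℤ) : star (shift (· + 1) (add_left_injective 1)) (basis n) = basis (n - 1) := by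
    have := star_shift_basis (add_left_injective (1 : ℤ)) (n - 1)
    rwa [sub_add_cancel] at this
  refine ⟨Unitary.mem_iff.2 ⟨star_shift_mul_shift _, ext_basis fun n => ?_⟩,
    star_shift_mul_shift _, ext_basis fun n => ?_, ext_basis fun n => ?_⟩
  · rw [mul_apply_eq_comp, hsucc, shift_basis, sub_add_cancel]; rfl
  · simp only [sq, mul_apply_eq_comp, shift_basis]
    congr 1; ring
  · simp only [add_apply, mul_apply_eq_comp, hsucc]
    have hodd (e : ℤ) : 2 * e + 1 ∉ Set.range (fun x : ℤ => 2 * x) := by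
      rintro ⟨k, hk⟩; simp only at hk; omega
    rcases Int.even_or_odd' n with ⟨e, rfl | rfl⟩
    · have h1 := star_shift_basis (mul_right_injective₀ (two_ne_zero (α := ℤ))) e
      have h2 := star_shift_basis_of_notMem (mul_right_injective₀ (two_ne_zero (α := ℤ)))
        (hodd (e - 1))
      rw [show 2 * (e - 1) + 1 = 2 * e - 1 by ring] at h2
      rw [h1, h2, shift_basis]
      simp
    · have h1 := star_shift_basis (mul_right_injective₀ (two_ne_zero (α := ℤ))) e
      have h2 := star_shift_basis_of_notMem (mul_right_injective₀ (two_ne_zero (α := ℤ))) (hodd e)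
      rw [add_sub_cancel_right, h1, h2, shift_basis, shift_basis]
      simp

end EllTwo

namespace Q2

instance : Nontrivial Q2 := by
  have hH : Nontrivial EllTwo := ⟨EllTwo.basis 0, 0, EllTwo.orthonormal_basis.ne_zero 0⟩
  refine ⟨1, 0, fun h => ?_⟩
  have := congr_arg (lift EllTwo.relations) h
  rw [map_one, map_zero] at this
  exact one_ne_zero this

end Q2

/-! ### Simplicity -/

/-- The generator `s` is not a scalar: a scalar isometry is unitary, and the second relation would
read `1 + 1 = 1`. -/
theorem Q2Relations.ne_algebraMap {A : Type*} [CStarAlgebra A] [Nontrivial A] {u s : A}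
    (h : Q2Relations u s) (c : ℂ) : s ≠ algebraMap ℂ A c := by
  intro hs
  have hc : s * star s = 1 := by
    rw [hs, ← algebraMap_star_comm, ← map_mul, mul_comm, map_mul, algebraMap_star_comm, ← hs,
      h.isometry]
  have h2 := h.rel_II
  rw [hc, mul_one, Unitary.mul_star_self_of_mem h.unitary] at h2
  exact one_ne_zero (add_eq_left.1 h2)

theorem isSimpleCStarAlgebra_of_exists_mul_mul_eq_one {A : Type*} [CStarAlgebra A] [Nontrivial A]
    (h : ∀ x : A, x ≠ 0 → ∃ y z : A, y * x * z = 1) : IsSimpleCStarAlgebra A := by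
  refine ⟨inferInstance, fun I _ => or_iff_not_imp_left.2 fun hI => ?_⟩
  obtain ⟨x, hx, hx0⟩ : ∃ x ∈ I, x ≠ 0 := by
    by_contra! hx
    refine hI (le_bot_iff.1 fun x hxI => ?_)
    rw [hx x hxI]; exact zero_mem _
  obtain ⟨y, z, hyz⟩ := h x hx0
  rw [← TwoSidedIdeal.one_mem_iff, ← hyz]
  exact I.mul_mem_right _ _ (I.mul_mem_left _ _ hx)

theorem theorem3p1 :
    -- `𝒬₂` is generated, as a C⋆-algebra, by a unitary `u` and an isometry `s₂` with the relations
    Q2Relations Q2.u Q2.s ∧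
    (StarAlgebra.adjoin ℂ {Q2.u, Q2.s}).topologicalClosure = ⊤ ∧
    -- and it is universal with this property
    (∀ (A : Type*) [CStarAlgebra A] (u s : A), Q2Relations u s →
      ∃! φ : Q2 →⋆ₐ[ℂ] A, φ Q2.u = u ∧ φ Q2.s = s) ∧
    -- it is simple and purely infinite
    IsSimpleCStarAlgebra Q2 ∧
    IsPurelyInfiniteSimple Q2 := by
  have hpi : ∀ x : Q2, x ≠ 0 → ∃ y z : Q2, y * x * z = 1 := fun x hx =>
    Q2Relations.exists_mul_mul_eq_one (U := ⟨Q2.u, Q2.relations.unitary⟩) Q2.relations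
      Q2.topologicalClosure_adjoin hx
  exact ⟨Q2.relations, Q2.topologicalClosure_adjoin, fun A _ u s h => Q2.existsUnique_hom h,
    isSimpleCStarAlgebra_of_exists_mul_mul_eq_one hpi,
    ⟨Q2.s, Q2.relations.ne_algebraMap⟩, hpi⟩
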